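/- Let $n$ be a positive integer and $k\in\{0,1,\dots,n\}$, and let $\mathcal{Q}_{n,k}\subset\mathbb{R}^n$ be the polytope defined by the inequalities $x_i\ge 0$ for $1\le i\le n$, $x_i\le 1$ for $1\le i\le k$, and $x_1+x_2+\cdots+x_n\le n$. Let $\mathrm{Ehr}(\mathcal{Q}_{n,k},t)$ be its Ehrhart polynomial, that is, the unique polynomial with $\mathrm{Ehr}(\mathcal{Q}_{n,k},m)=\#(m\mathcal{Q}_{n,k}\cap\mathbb{N}^n)$ for every $m\in\mathbb{N}=\{0,1,2,\dots\}$, and let $h^*(\mathcal{Q}_{n,k},t)$ be its $h^*$-polynomial, that is, the unique polynomial with $$\sum_{m\ge 0}\mathrm{Ehr}(\mathcal{Q}_{n,k},m)\,t^m=\frac{h^*(\mathcal{Q}_{n,k},t)}{(1-t)^{d+1}},\qquad d=\dim(\mathcal{Q}_{n,k}).$$ Both polynomials exist and are unique, and there are nonnegative integers $c_0,c_1,\dots,c_n$ such that $$n!\,\mathrm{Ehr}(\mathcal{Q}_{n,k},t)=\sum_{i=0}^n c_i\,t^i(1+t)^{n-i}.$$ In particular, all complex roots of $h^*(\mathcal{Q}_{n,k},t)$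 are real. -/

import Mathlib

open Polynomial
open scoped Pointwise Nat

/-- The polytope `Q_{n,k}` in `ℝⁿ`: all coordinates are nonnegative, the first `k` coordinates are
at most `1`, and the sum of the coordinates is at most `n`. -/
def polytopeQ (n k : ℕ) : Set (Fin n → ℝ) :=
  {x | (∀ i, 0 ≤ x i) ∧ (∀ i : Fin n, (i : ℕ) < k → x i ≤ 1) ∧ ∑ i, x i ≤ (n : ℝ)}

/-- The number of points of `ℕⁿ` in the dilate `m • Q` (for a bounded set `Q`, so that this
number is finite). -/
noncomputable def latticePointCount {n : ℕ} (Q : Set (Fin n → ℝ)) (m : ℕ) : ℕ :=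
  Set.ncard {x : Fin n → ℕ | (fun i => (x i : ℝ)) ∈ (m : ℝ) • Q}

/-- `E` is the Ehrhart polynomial of the lattice polytope `Q` contained in the nonnegative
orthant. -/
def IsEhrhartPolynomial {n : ℕ} (Q : Set (Fin n → ℝ)) (E : ℚ[X]) : Prop :=
  ∀ m : ℕ, E.eval (m : ℚ) = (latticePointCount Q m : ℚ)

/-- The dimension of a subset of `ℝⁿ`, that is, of its affine hull. -/
noncomputable def polytopeDim {n : ℕ} (Q : Set (Fin n → ℝ)) : ℕ :=
  Module.finrank ℝ (affineSpan ℝ Q).direction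

/-- `h` is the `h*`-polynomial of the lattice polytope `Q`: with `E` the Ehrhart polynomial and `d`
the dimension of `Q`, the generating function of the values `E(m)` is `h(t) / (1 - t)^(d+1)`,
an identity of formal power series. -/
def IsHStarPolynomial {n : ℕ} (Q : Set (Fin n → ℝ)) (h : ℚ[X]) : Prop :=
  ∃ E : ℚ[X], IsEhrhartPolynomial Q E ∧
    PowerSeries.mk (fun m : ℕ => E.eval (m : ℚ)) * (1 - PowerSeries.X) ^ (polytopeDim Q + 1)
      = (h : PowerSeries ℚ)

/-- All complex roots of `p` are real (this fails for the zero polynomial). -/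
def IsRealRooted (p : ℚ[X]) : Prop :=
  ∀ z : ℂ, aeval z p = 0 → z.im = 0

/-!
The number of points of `ℕⁿ` in `m • polytopeQ n k` is found by capping one coordinate at a time.
Without caps, the points with coordinate sum at most `y (m + 1) - n` are counted by a binomial
coefficient, `n!` times which is `∏_{l < n} (y (m + 1) - l)`. Each cap is a backward difference in
`y`, since the points violating it are translates of the points counted at `y - 1`. So `n!` times
the Ehrhart polynomial is the `k`-th backward difference of `∏_{l < n} (y (1 + X) - l)` at `y = n`
(`eval_fallingDiff_self`).

Each factor is `(y - l) (1 + X) + l X`. Applying the Leibniz rule for differences to the factors in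
the order `l = n - 1, …, 0`, each factor either stays, or is differenced to `1 + X` and lowers `y`
by one for the factors that follow. Since `y` is lowered at most once per factor, `y ≥ l` always
holds when factor `l` is reached, so that only nonnegative integer combinations of the
`X ^ i (1 + X) ^ (n - i)` arise (`isMagicPositive_fallingDiff`).

The series `∑ m ^ i (m + 1) ^ (d - i) X ^ m` is `A_{d,i} / (1 - X) ^ (d + 1)`, where
`A_{d+1,i} = X ∑_{j < i} A_{d,j} + ∑_{i ≤ j ≤ d} A_{d,j}` (`coe_eulerianRefinement`). At a point
`z` of the upper half-plane this recursion preserves the property that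
`A_{d,0}(z), …, A_{d,d}(z), z A_{d,0}(z)` are ordered by argument within a half-turn
(`IsArgIncreasing.step`); this is the pointwise form of interlacing. Hence no nonnegative
combination of the `A_{d,i}`, other than the trivial one, vanishes in the upper half-plane
(`aeval_sum_eulerianRefinement_ne_zero`), and `h*` is such a combination, up to the factor `n!`.
-/

/-! ### Counting lattice points -/

/-- The points with `x i > m` are translates of the points counted by the last term. -/
theorem ncard_eq_ncard_le_add_ncard_shift {n : ℕ} {S : Set (Fin n → ℕ)} (hS : S.Finite)
    (i : Fin n) (m : ℕ) :
    S.ncard = {x ∈ S | x i ≤ m}.ncard + {x | x + (Pi.single i (m + 1) : Fin n → ℕ) ∈ S}.ncard := by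
  have himg : (fun x : Fin n → ℕ => x + (Pi.single i (m + 1) : Fin n → ℕ)) ''
      {x | x + (Pi.single i (m + 1) : Fin n → ℕ) ∈ S} = {x ∈ S | ¬ x i ≤ m} := by
    ext x
    constructor
    · rintro ⟨y, hy, rfl⟩
      refine ⟨hy, ?_⟩
      simp only [Pi.add_apply, Pi.single_eq_same]
      omega
    · rintro ⟨hx, hxi⟩
      have hle : (Pi.single i (m + 1) : Fin n → ℕ) ≤ x := by
        intro j
        by_cases h : j = i
        · subst h
          simp only [Pi.single_eq_same]
          omega
        · simp [h]
      have hsub : x - (Pi.single i (m + 1) : Fin n → ℕ) + (Pi.single i (m + 1) : Fin n → ℕ) = x :=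
        tsub_add_cancel_of_le hle
      exact ⟨x - (Pi.single i (m + 1) : Fin n → ℕ),
        by simpa only [Set.mem_ofPred_eq, hsub] using hx, hsub⟩
  rw [← Set.ncard_image_of_injective
    (f := fun x : Fin n → ℕ => x + (Pi.single i (m + 1) : Fin n → ℕ))
    {x | x + (Pi.single i (m + 1) : Fin n → ℕ) ∈ S} (add_left_injective _), himg,
    ← Set.ncard_union_eq (Set.disjoint_left.2 fun x h1 h2 => h2.2 h1.2)
      (hS.subset fun x h => h.1) (hS.subset fun x h => h.1)]
  congr 1
  ext x
  simp only [Set.mem_union, Set.mem_ofPred_eq]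
  tauto

theorem finite_setOf_sum_add_le (n T : ℕ) : {x : Fin n → ℕ | ∑ i, x i + n ≤ T}.Finite := by
  refine (Set.finite_Iic (fun _ => T : Fin n → ℕ)).subset fun x hx i => ?_
  have := Finset.single_le_sum (f := x) (fun _ _ => Nat.zero_le _) (Finset.mem_univ i)
  simp only [Set.mem_ofPred_eq] at hx
  change x i ≤ T
  omega

theorem sum_add_single {n : ℕ} (x : Fin n → ℕ) (i : Fin n) (a : ℕ) :
    ∑ j, (x + (Pi.single i a : Fin n → ℕ)) j = ∑ j, x j + a := by
  simp [Finset.sum_add_distrib]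

/-- The number of points of `ℕⁿ` in a dilated standard simplex; splitting off the points with
`x 0 = 0` gives Pascal's rule. -/
theorem ncard_sum_add_le (n T : ℕ) : {x : Fin n → ℕ | ∑ i, x i + n ≤ T}.ncard = T.choose n := by
  induction T generalizing n with
  | zero =>
    cases n with
    | zero => simp
    | succ n => simp
  | succ T ih =>
    cases n with
    | zero => simp
    | succ n =>
      rw [ncard_eq_ncard_le_add_ncard_shift (finite_setOf_sum_add_le _ _) 0 0, Nat.choose_succ_succ',
        ← ih, ← ih]
      congr 1
      · rw [← Set.ncard_image_of_injective 
          (f := fun x : Fin n → ℕ => (Fin.cons 0 x : Fin (n + 1) → ℕ)) _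
          (Fin.cons_right_injective (α := fun _ => ℕ) 0)]
        congr 1
        ext x
        constructor
        · rintro ⟨h1, h2⟩
          refine ⟨Fin.tail x, ?_, ?_⟩
          · simp only [Set.mem_ofPred_eq, Fin.sum_univ_succ] at h1
            simp only [Set.mem_ofPred_eq, Fin.tail]
            omega
          · have : x 0 = 0 := by omega
            conv_rhs => rw [← Fin.cons_self_tail x, this]
        · rintro ⟨y, hy, rfl⟩
          simp only [Set.mem_ofPred_eq] at hy
          simp only [Set.mem_ofPred_eq, Fin.sum_univ_succ, Fin.cons_zero, Fin.cons_succ]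
          omega
      · congr 1
        ext x
        simp only [Set.mem_ofPred_eq, sum_add_single]
        omega

/-- The points `x` of `ℕⁿ` whose first `k` coordinates are at most `m` and whose coordinate sum is
at most `y * (m + 1) - n`; the last condition is written without subtraction. For `y = n` these are
the lattice points of the dilate `m • polytopeQ n k`. -/
def cappedSimplex (n m k y : ℕ) : Set (Fin n → ℕ) :=
  {x | (∀ i : Fin n, (i : ℕ) < k → x i ≤ m) ∧ ∑ i, x i + n ≤ y * (m + 1)}

theorem ncard_cappedSimplex_zero (n m y : ℕ) :
    (cappedSimplex n m 0 y).ncard = (y * (m + 1)).choose n := by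
  rw [← ncard_sum_add_le]
  simp [cappedSimplex]

/-- Capping one more coordinate is a backward difference in `y`: the points violating the new
bound are translates of the points counted at `y`. -/
theorem ncard_cappedSimplex_succ (n m k y : ℕ) (hk : k < n) :
    (cappedSimplex n m k (y + 1)).ncard
      = (cappedSimplex n m (k + 1) (y + 1)).ncard + (cappedSimplex n m k y).ncard := by
  rw [ncard_eq_ncard_le_add_ncard_shift
    ((finite_setOf_sum_add_le n ((y + 1) * (m + 1))).subset fun x hx => hx.2) ⟨k, hk⟩ m]
  congr 2
  · ext x
    simp only [cappedSimplex, Set.mem_ofPred_eq]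
    constructor
    · rintro ⟨⟨h1, h2⟩, h3⟩
      refine ⟨fun i hi => ?_, h2⟩
      rcases Nat.lt_succ_iff_lt_or_eq.1 hi with h | h
      · exact h1 i h
      · have : i = ⟨k, hk⟩ := Fin.ext h
        rwa [this]
    · rintro ⟨h1, h2⟩
      exact ⟨⟨fun i hi => h1 i (by omega), h2⟩, h1 _ (by simp)⟩
  · ext x
    simp only [cappedSimplex, Set.mem_ofPred_eq, sum_add_single]
    refine and_congr (forall_congr' fun i => ?_) ?_
    · refine imp_congr_right fun hi => ?_
      have : i ≠ ⟨k, hk⟩ := fun h => by simp [h] at hi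
      simp [this]
    · rw [Nat.succ_mul]
      omega

theorem latticePointCount_polytopeQ (n k m : ℕ) :
    latticePointCount (polytopeQ n k) m = (cappedSimplex n m k n).ncard := by
  unfold latticePointCount
  congr 1
  ext x
  have hsum : ∑ i, x i + n ≤ n * (m + 1) ↔ (∑ i, (x i : ℝ)) ≤ m * n := by
    rw [← Nat.cast_sum, ← Nat.cast_mul, Nat.cast_le, Nat.mul_succ, mul_comm n m]
    omega
  simp only [cappedSimplex, Set.mem_ofPred_eq, hsum]
  rcases Nat.eq_zero_or_pos m with rfl | hm
  · -- `0 • Q` is the origin, because `Q` is not empty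
    have hne : (polytopeQ n k).Nonempty := ⟨0, by simp [polytopeQ]⟩
    rw [Nat.cast_zero, Set.zero_smul_set hne, Set.mem_zero]
    constructor
    · intro h
      have hx : ∀ i, x i = 0 := fun i => by simpa using congrFun h i
      simp [hx]
    · rintro ⟨-, h⟩
      rw [zero_mul] at h
      have h0 := (Finset.sum_eq_zero_iff_of_nonneg (fun i _ => Nat.cast_nonneg (α := ℝ) (x i))).1
        (le_antisymm h (Finset.sum_nonneg fun i _ => Nat.cast_nonneg _))
      exact funext fun i => h0 i (Finset.mem_univ i)
  · have hm' : (0 : ℝ) < m := by exact_mod_cast hm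
    rw [Set.mem_smul_set_iff_inv_smul_mem₀ hm'.ne']
    simp only [polytopeQ, Set.mem_ofPred_eq, Pi.smul_apply, smul_eq_mul, ← Finset.mul_sum]
    simp only [inv_mul_le_iff₀ hm', mul_one, Nat.cast_le]
    exact ⟨fun h => h.2, fun h => ⟨fun i => by positivity, h⟩⟩

/-- The polytope contains the origin and, as `0 < n`, the standard basis vectors. -/
theorem polytopeDim_polytopeQ {n : ℕ} (k : ℕ) (hn : 0 < n) : polytopeDim (polytopeQ n k) = n := by
  have h0 : (0 : Fin n → ℝ) ∈ polytopeQ n k := by simp [polytopeQ]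
  have h1 : ∀ i : Fin n, Pi.single i (1 : ℝ) ∈ polytopeQ n k := by
    intro i
    refine ⟨fun j => ?_, fun j _ => ?_, ?_⟩
    · by_cases h : j = i
      · subst h; simp
      · simp [h]
    · by_cases h : j = i
      · subst h; simp
      · simp [h]
    · simpa using (Nat.one_le_cast (α := ℝ)).2 hn
  have htop : (affineSpan ℝ (polytopeQ n k)).direction = ⊤ := by
    rw [direction_affineSpan, eq_top_iff, ← (Pi.basisFun ℝ (Fin n)).span_eq, Submodule.span_le]
    rintro _ ⟨i, rfl⟩
    have := vsub_mem_vectorSpan ℝ (h1 i) h0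
    simpa using this
  rw [polytopeDim, htop, finrank_top, Module.finrank_fin_fun]

/-! ### Backward differences and positivity -/

/-- The `k`-th backward difference in `x` of `∏_{l < m} (x (1 + X) - l)`, a polynomial in `X`. -/
noncomputable def fallingDiff (m : ℕ) : ℕ → ℤ → ℚ[X]
  | 0, x => ∏ l ∈ Finset.range m, (C (x : ℚ) * (1 + X) - C (l : ℚ))
  | k + 1, x => fallingDiff m k x - fallingDiff m k (x - 1)

theorem fallingDiff_diff (m k : ℕ) (x : ℤ) :
    fallingDiff m (k + 1) x = fallingDiff m k x - fallingDiff m k (x - 1) := rfl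

theorem fallingDiff_zero_succ (k : ℕ) (x : ℤ) : fallingDiff 0 (k + 1) x = 0 := by
  induction k generalizing x with
  | zero => simp [fallingDiff]
  | succ k ih => rw [fallingDiff_diff, ih, ih, sub_zero]

theorem fallingDiff_succ_zero (m : ℕ) (x : ℤ) :
    fallingDiff (m + 1) 0 x
      = (C ((x - m : ℤ) : ℚ) * (1 + X) + C (m : ℚ) * X) * fallingDiff m 0 x := by
  rw [fallingDiff, Finset.prod_range_succ, mul_comm, fallingDiff]
  congr 1
  simp
  ring

/-- Leibniz rule for the last factor. Evaluating the differentiated term at `x - 1` keeps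
`x ≥ m` invariant along the recursion, which is what makes the coefficients nonnegative. -/
theorem fallingDiff_succ_succ (m k : ℕ) (x : ℤ) :
    fallingDiff (m + 1) (k + 1) x
      = (C ((x - m : ℤ) : ℚ) * (1 + X) + C (m : ℚ) * X) * fallingDiff m (k + 1) x
        + C ((k + 1 : ℕ) : ℚ) * (1 + X) * fallingDiff m k (x - 1) := by
  induction k generalizing x with
  | zero =>
    rw [fallingDiff_diff, fallingDiff_succ_zero, fallingDiff_succ_zero, fallingDiff_diff]
    simp
    ring
  | succ k ih =>
    rw [fallingDiff_diff, ih, ih, fallingDiff_diff m (k + 1), fallingDiff_diff m k (x - 1)]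
    simp
    ring

/-- `p` is a combination of the polynomials `X ^ i * (1 + X) ^ (d - i)`, `i ≤ d`, with nonnegative
integer coefficients. -/
def IsMagicPositive (d : ℕ) (p : ℚ[X]) : Prop :=
  ∃ c : ℕ → ℕ, p = ∑ i ∈ Finset.range (d + 1), C (c i : ℚ) * X ^ i * (1 + X) ^ (d - i)

namespace IsMagicPositive

variable {d : ℕ} {p q : ℚ[X]}

theorem zero (d : ℕ) : IsMagicPositive d 0 := ⟨0, by simp⟩

theorem one : IsMagicPositive 0 1 := ⟨1, by simp⟩

theorem add (hp : IsMagicPositive d p) (hq : IsMagicPositive d q) : IsMagicPositive d (p + q) := by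
  obtain ⟨a, rfl⟩ := hp
  obtain ⟨b, rfl⟩ := hq
  refine ⟨a + b, ?_⟩
  rw [← Finset.sum_add_distrib]
  refine Finset.sum_congr rfl fun i _ => ?_
  simp
  ring

theorem natCast_mul (a : ℕ) (hp : IsMagicPositive d p) : IsMagicPositive d (C (a : ℚ) * p) := by
  obtain ⟨c, rfl⟩ := hp
  refine ⟨fun i => a * c i, ?_⟩
  rw [Finset.mul_sum]
  refine Finset.sum_congr rfl fun i _ => ?_
  simp
  ring

theorem X_mul (hp : IsMagicPositive d p) : IsMagicPositive (d + 1) (X * p) := by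
  obtain ⟨c, rfl⟩ := hp
  refine ⟨fun i => if i = 0 then 0 else c (i - 1), ?_⟩
  rw [Finset.sum_range_succ' _ (d + 1), Finset.mul_sum]
  simp only [if_true, Nat.cast_zero, C_0, zero_mul, add_zero]
  refine Finset.sum_congr rfl fun i _ => ?_
  simp
  ring

theorem one_add_X_mul (hp : IsMagicPositive d p) : IsMagicPositive (d + 1) ((1 + X) * p) := by
  obtain ⟨c, rfl⟩ := hp
  refine ⟨fun i => if i = d + 1 then 0 else c i, ?_⟩
  rw [Finset.sum_range_succ _ (d + 1), Finset.mul_sum]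
  simp only [if_true, Nat.cast_zero, C_0, zero_mul, add_zero]
  refine Finset.sum_congr rfl fun i hi => ?_
  have hi' : i ≤ d := by simpa [Nat.lt_succ_iff] using hi
  rw [if_neg (by omega), Nat.succ_sub hi', pow_succ]
  ring

end IsMagicPositive

theorem isMagicPositive_fallingDiff (m k : ℕ) (x : ℤ) (hx : (m : ℤ) ≤ x) :
    IsMagicPositive m (fallingDiff m k x) := by
  induction m generalizing k x with
  | zero =>
    cases k with
    | zero => simpa [fallingDiff] using IsMagicPositive.one
    | succ k => simpa [fallingDiff_zero_succ] using IsMagicPositive.zero 0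
  | succ m ih =>
    have hfac : ∀ p, IsMagicPositive m p →
        IsMagicPositive (m + 1) ((C ((x - m : ℤ) : ℚ) * (1 + X) + C (m : ℚ) * X) * p) := by
      intro p hp
      lift x - m to ℕ using by push_cast at hx; omega with a
      have := (hp.one_add_X_mul.natCast_mul a).add (hp.X_mul.natCast_mul m)
      convert this using 1
      rw [Int.cast_natCast]
      ring
    cases k with
    | zero =>
      rw [fallingDiff_succ_zero]
      exact hfac _ (ih 0 x (by push_cast at hx; omega))
    | succ k =>
      rw [fallingDiff_succ_succ]
      refine (hfac _ (ih (k + 1) x (by push_cast at hx; omega))).add ?_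
      rw [mul_assoc]
      exact ((ih k (x - 1) (by push_cast at hx; omega)).one_add_X_mul).natCast_mul _

theorem eval_fallingDiff (n m k y : ℕ) (hkn : k ≤ n) (hky : k ≤ y) :
    (fallingDiff n k y).eval (m : ℚ) = n ! * ((cappedSimplex n m k y).ncard : ℚ) := by
  induction k generalizing y with
  | zero =>
    rw [ncard_cappedSimplex_zero, ← Nat.cast_mul, ← Nat.descFactorial_eq_factorial_mul_choose,
      ← descPochhammer_eval_eq_descFactorial, descPochhammer_eval_eq_prod_range, fallingDiff,
      eval_prod]
    refine Finset.prod_congr rfl fun l _ => ?_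
    simp only [eval_sub, eval_mul, eval_C, eval_add, eval_one, eval_X, Int.cast_natCast]
    push_cast
    ring
  | succ k ih =>
    obtain ⟨y, rfl⟩ : ∃ z, y = z + 1 := ⟨y - 1, by omega⟩
    have hy : ((y + 1 : ℕ) : ℤ) - 1 = (y : ℕ) := by push_cast; ring
    rw [fallingDiff_diff, eval_sub, hy, ih _ (by omega) (by omega), ih _ (by omega) (by omega),
      ncard_cappedSimplex_succ n m k y (by omega)]
    push_cast
    ring

theorem eval_fallingDiff_self {n k : ℕ} (hk : k ≤ n) (m : ℕ) :
    (fallingDiff n k n).eval (m : ℚ) = n ! * (latticePointCount (polytopeQ n k) m : ℚ) := by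
  rw [latticePointCount_polytopeQ]
  exact eval_fallingDiff n m k n hk hk

theorem polynomial_eq_of_eval_natCast {p q : ℚ[X]} (h : ∀ m : ℕ, p.eval (m : ℚ) = q.eval (m : ℚ)) :
    p = q :=
  eq_of_infinite_eval_eq p q <|
    (Set.infinite_range_of_injective (Nat.cast_injective (R := ℚ))).mono <| by
      rintro _ ⟨m, rfl⟩
      exact h m

theorem isEhrhartPolynomial_iff {n k : ℕ} (hk : k ≤ n) (E : ℚ[X]) :
    IsEhrhartPolynomial (polytopeQ n k) E ↔ C (n ! : ℚ) * E = fallingDiff n k n := by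
  have hn : (n ! : ℚ) ≠ 0 := by exact_mod_cast n.factorial_ne_zero
  constructor
  · intro h
    refine polynomial_eq_of_eval_natCast fun m => ?_
    rw [eval_fallingDiff_self hk, ← h m, eval_mul, eval_C]
  · intro h m
    have := congrArg (eval (m : ℚ)) h
    rw [eval_fallingDiff_self hk, eval_mul, eval_C] at this
    exact mul_left_cancel₀ hn this

/-! ### Numerators of the generating functions of `m ^ i * (m + 1) ^ (d - i)` -/

/-- The numerators of the generating functions of `m ↦ m ^ i * (m + 1) ^ (d - i)`, `i ≤ d`: see
`coe_eulerianRefinement`. For `i = 0` these are Eulerian polynomials. The values for `i > d` carry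
no meaning and are never used. -/
noncomputable def eulerianRefinement : ℕ → ℕ → ℚ[X]
  | 0, _ => 1
  | d + 1, i => ∑ j ∈ Finset.range (d + 1), eulerianRefinement d j
      + (X - 1) * ∑ j ∈ Finset.range i, eulerianRefinement d j

/-- The series `∑ m ^ i * (m + 1) ^ (d - i) * X ^ m`, multiplied by `(1 - X) ^ (d + 1)`. -/
noncomputable def numeratorSeries (d i : ℕ) : PowerSeries ℚ :=
  PowerSeries.mk (fun m : ℕ => (m : ℚ) ^ i * ((m : ℚ) + 1) ^ (d - i))
    * (1 - PowerSeries.X) ^ (d + 1)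

/-- This is `m ^ i * (m + 1) ^ (d + 1 - i) - m ^ (i + 1) * (m + 1) ^ (d - i)
= m ^ i * (m + 1) ^ (d - i)` for generating functions. -/
theorem numeratorSeries_succ_succ {d i : ℕ} (hi : i ≤ d) :
    numeratorSeries (d + 1) (i + 1)
      = numeratorSeries (d + 1) i + (PowerSeries.X - 1) * numeratorSeries d i := by
  have h : PowerSeries.mk (fun m : ℕ => (m : ℚ) ^ (i + 1) * ((m : ℚ) + 1) ^ (d + 1 - (i + 1)))
      = PowerSeries.mk (fun m : ℕ => (m : ℚ) ^ i * ((m : ℚ) + 1) ^ (d + 1 - i))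
        - PowerSeries.mk (fun m : ℕ => (m : ℚ) ^ i * ((m : ℚ) + 1) ^ (d - i)) := by
    ext m
    simp only [PowerSeries.coeff_mk, map_sub]
    rw [Nat.succ_sub_succ, Nat.succ_sub hi, pow_succ ((m : ℚ) + 1)]
    ring
  rw [numeratorSeries, h, numeratorSeries, numeratorSeries]
  ring

/-- The index shift `m ^ (d + 1) = ((m - 1) + 1) ^ (d + 1)`; the term `m = 0` vanishes. -/
theorem numeratorSeries_self (d : ℕ) :
    numeratorSeries (d + 1) (d + 1) = PowerSeries.X * numeratorSeries (d + 1) 0 := by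
  rw [numeratorSeries, numeratorSeries, ← mul_assoc]
  congr 1
  ext m
  cases m with
  | zero => simp
  | succ m => simp [PowerSeries.coeff_succ_X_mul]

theorem numeratorSeries_succ {d i : ℕ} (hi : i ≤ d + 1) :
    numeratorSeries (d + 1) i = numeratorSeries (d + 1) 0
      + (PowerSeries.X - 1) * ∑ j ∈ Finset.range i, numeratorSeries d j := by
  induction i with
  | zero => simp
  | succ i ih =>
    rw [numeratorSeries_succ_succ (by omega), ih (by omega), Finset.sum_range_succ]
    ring

/-- Telescoping up to `i = d + 1` and `numeratorSeries_self` leave a common factor `X - 1`. -/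
theorem numeratorSeries_succ_zero (d : ℕ) :
    numeratorSeries (d + 1) 0 = ∑ j ∈ Finset.range (d + 1), numeratorSeries d j := by
  have h := numeratorSeries_succ (le_refl (d + 1))
  rw [numeratorSeries_self] at h
  have hX : (PowerSeries.X - 1 : PowerSeries ℚ) ≠ 0 := by
    intro h0
    have := congrArg PowerSeries.constantCoeff h0
    simp at this
  refine mul_left_cancel₀ hX ?_
  rw [sub_mul, one_mul, h]
  ring

theorem coe_eulerianRefinement {d i : ℕ} (hi : i ≤ d) :
    (eulerianRefinement d i : PowerSeries ℚ) = numeratorSeries d i := by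
  induction d generalizing i with
  | zero =>
    obtain rfl : i = 0 := by omega
    have : PowerSeries.mk (fun m : ℕ => (m : ℚ) ^ 0 * ((m : ℚ) + 1) ^ (0 - 0))
        = PowerSeries.mk 1 := by ext; simp
    rw [numeratorSeries, this, eulerianRefinement, zero_add, pow_one,
      PowerSeries.mk_one_mul_one_sub_eq_one, coe_one]
  | succ d ih =>
    have hsum : ∀ r ≤ d + 1, ((∑ j ∈ Finset.range r, eulerianRefinement d j : ℚ[X]) : PowerSeries ℚ)
        = ∑ j ∈ Finset.range r, numeratorSeries d j := by
      intro r hr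
      rw [← coeToPowerSeries.ringHom_apply, map_sum]
      refine Finset.sum_congr rfl fun j hj => ?_
      rw [coeToPowerSeries.ringHom_apply, ih]
      have := Finset.mem_range.1 hj
      omega
    rw [eulerianRefinement, coe_add, coe_mul, hsum _ le_rfl, hsum _ hi, coe_sub, coe_X, coe_one,
      numeratorSeries_succ hi, numeratorSeries_succ_zero]

/-! ### Real roots: arguments on the upper half-plane -/

/-- For a point `z` of the upper half-plane: `a 0, …, a d, z * a 0` are nonzero and listed by
increasing argument, within a half-turn. The field `nonneg` compares `z * a i` with `a j`; its case
`i = 0` says that `z * a 0` comes last, the other cases are kept for the induction. -/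
structure IsArgIncreasing (z : ℂ) (d : ℕ) (a : ℕ → ℂ) : Prop where
  ne_zero : ∀ i ≤ d, a i ≠ 0
  pos : ∀ i j, i < j → j ≤ d → 0 < (a j * starRingEnd ℂ (a i)).im
  nonneg : ∀ i j, i ≤ j → j ≤ d → 0 ≤ (z * a i * starRingEnd ℂ (a j)).im

theorem im_sum_mul_conj_sum (s t : Finset ℕ) (a : ℕ → ℂ) (w : ℂ) :
    (w * (∑ i ∈ s, a i) * starRingEnd ℂ (∑ j ∈ t, a j)).im
      = ∑ i ∈ s, ∑ j ∈ t, (w * a i * starRingEnd ℂ (a j)).im := by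
  rw [map_sum, Finset.mul_sum s, Finset.sum_mul_sum, Complex.im_sum]
  exact Finset.sum_congr rfl fun i _ => Complex.im_sum _ _

/-- `P`, `M`, `R` stand for the sums of `a l` over three consecutive blocks of indices; on the right
all terms are quantities whose sign `IsArgIncreasing` controls. -/
theorem im_cross_first (z P M R : ℂ) :
    ((z * P + z * M + R) * starRingEnd ℂ (z * P + M + R)).im
      = z.im * Complex.normSq M + (z * P * starRingEnd ℂ M).im
        + Complex.normSq z * (M * starRingEnd ℂ P).im
        + (z * M * starRingEnd ℂ R).im + (R * starRingEnd ℂ M).im := by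
  simp [Complex.normSq_apply]
  ring

theorem im_cross_second (z P M R : ℂ) :
    (z * (z * P + M + R) * starRingEnd ℂ (z * P + z * M + R)).im
      = z.im * Complex.normSq (z * P + R) + Complex.normSq z * (z * P * starRingEnd ℂ M).im
        + Complex.normSq z * (M * starRingEnd ℂ P).im
        + (z * M * starRingEnd ℂ R).im + Complex.normSq z * (R * starRingEnd ℂ M).im := by
  simp [Complex.normSq_apply]
  ring

/-- The recursion defining `eulerianRefinement`, at the point `z`, preserves the order of the
arguments. -/
theorem IsArgIncreasing.step {z : ℂ} (hz : 0 < z.im) {d : ℕ} {a : ℕ → ℂ}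
    (ha : IsArgIncreasing z d a) :
    IsArgIncreasing z (d + 1) fun i =>
      ∑ j ∈ Finset.range (d + 1), a j + (z - 1) * ∑ j ∈ Finset.range i, a j := by
  set b : ℕ → ℂ := fun i =>
    ∑ j ∈ Finset.range (d + 1), a j + (z - 1) * ∑ j ∈ Finset.range i, a j with hb
  have hpos' : ∀ i j, i ≤ j → j ≤ d → 0 ≤ (1 * a j * starRingEnd ℂ (a i)).im := by
    intro i j hij hj
    rcases hij.lt_or_eq with h | rfl
    · simpa using (ha.pos i j h hj).le
    · rw [one_mul, Complex.mul_conj, Complex.ofReal_im]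
  -- the sums before `i`, from `i` to `j`, and from `j` on
  have hblock : ∀ i j, i ≤ j → j ≤ d + 1 → ∃ P M R : ℂ,
      b i = z * P + M + R ∧ b j = z * P + z * M + R ∧
      0 ≤ (z * P * starRingEnd ℂ M).im ∧ 0 ≤ (M * starRingEnd ℂ P).im ∧
      0 ≤ (z * M * starRingEnd ℂ R).im ∧ 0 ≤ (R * starRingEnd ℂ M).im ∧
      (i < j → M ≠ 0) := by
    intro i j hij hj
    have h1 : ∑ l ∈ Finset.range j, a l
        = ∑ l ∈ Finset.range i, a l + ∑ l ∈ Finset.Ico i j, a l :=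
      (Finset.sum_range_add_sum_Ico a hij).symm
    have h2 : ∑ l ∈ Finset.range (d + 1), a l
        = ∑ l ∈ Finset.range j, a l + ∑ l ∈ Finset.Ico j (d + 1), a l :=
      (Finset.sum_range_add_sum_Ico a hj).symm
    refine ⟨∑ l ∈ Finset.range i, a l, ∑ l ∈ Finset.Ico i j, a l, ∑ l ∈ Finset.Ico j (d + 1), a l,
      ?_, ?_, ?_, ?_, ?_, ?_, ?_⟩
    · simp only [hb]
      rw [h2, h1]
      ring
    · simp only [hb]
      rw [h2, h1]
      ring
    · rw [im_sum_mul_conj_sum]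
      refine Finset.sum_nonneg fun l hl => Finset.sum_nonneg fun l' hl' => ?_
      simp only [Finset.mem_range, Finset.mem_Ico] at hl hl'
      exact ha.nonneg _ _ (by omega) (by omega)
    · rw [← one_mul (∑ l ∈ Finset.Ico i j, a l), im_sum_mul_conj_sum]
      refine Finset.sum_nonneg fun l hl => Finset.sum_nonneg fun l' hl' => ?_
      simp only [Finset.mem_range, Finset.mem_Ico] at hl hl'
      exact hpos' _ _ (by omega) (by omega)
    · rw [im_sum_mul_conj_sum]
      refine Finset.sum_nonneg fun l hl => Finset.sum_nonneg fun l' hl' => ?_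
      simp only [Finset.mem_Ico] at hl hl'
      exact ha.nonneg _ _ (by omega) (by omega)
    · rw [← one_mul (∑ l ∈ Finset.Ico j (d + 1), a l), im_sum_mul_conj_sum]
      refine Finset.sum_nonneg fun l hl => Finset.sum_nonneg fun l' hl' => ?_
      simp only [Finset.mem_Ico] at hl hl'
      exact hpos' _ _ (by omega) (by omega)
    · -- the summands after `a i` all lie strictly to the left of the line through `a i`
      intro hlt h0
      rw [Finset.sum_eq_sum_Ico_succ_bot hlt] at h0
      rcases Nat.lt_or_ge (i + 1) j with h | h
      · have him := congrArg (fun w => (w * starRingEnd ℂ (a i)).im) h0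
        simp only [add_mul, Finset.sum_mul, Complex.add_im, Complex.im_sum, zero_mul,
          Complex.zero_im, Complex.mul_conj, Complex.ofReal_im, zero_add] at him
        have : 0 < ∑ l ∈ Finset.Ico (i + 1) j, (a l * starRingEnd ℂ (a i)).im := by
          refine Finset.sum_pos (fun l hl => ?_) (by simpa using h)
          simp only [Finset.mem_Ico] at hl
          exact ha.pos _ _ (by omega) (by omega)
        linarith
      · rw [Finset.Ico_eq_empty (by omega), Finset.sum_empty, add_zero] at h0
        exact ha.ne_zero i (by omega) h0
  have hbpos : ∀ i j, i < j → j ≤ d + 1 → 0 < (b j * starRingEnd ℂ (b i)).im := by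
    intro i j hij hj
    obtain ⟨P, M, R, hi, hj', h1, h2, h3, h4, hM⟩ := hblock i j hij.le hj
    rw [hi, hj', im_cross_first]
    have := mul_pos hz (Complex.normSq_pos.2 (hM hij))
    have := mul_nonneg (Complex.normSq_nonneg z) h2
    linarith
  refine ⟨fun i hi h0 => ?_, hbpos, fun i j hij hj => ?_⟩
  · rcases Nat.lt_or_ge i (d + 1) with h | h
    · have := hbpos i (d + 1) h le_rfl
      rw [h0] at this
      simp at this
    · have := hbpos 0 i (by omega) hi
      rw [h0] at this
      simp at this
  · obtain ⟨P, M, R, hi, hj', h1, h2, h3, h4, -⟩ := hblock i j hij hj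
    rw [hi, hj', im_cross_second]
    have := mul_nonneg hz.le (Complex.normSq_nonneg (z * P + R))
    have hn := Complex.normSq_nonneg z
    have := mul_nonneg hn h1
    have := mul_nonneg hn h2
    have := mul_nonneg hn h4
    linarith

theorem isArgIncreasing_eulerianRefinement {z : ℂ} (hz : 0 < z.im) (d : ℕ) :
    IsArgIncreasing z d fun i => aeval z (eulerianRefinement d i) := by
  induction d with
  | zero =>
    refine ⟨fun i _ => by simp [eulerianRefinement], fun i j _ _ => by omega, fun i j _ _ => ?_⟩
    simpa [eulerianRefinement] using hz.le
  | succ d ih =>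
    convert ih.step hz using 2 with i
    simp [eulerianRefinement, map_sum]

/-- In the upper half-plane the values of `eulerianRefinement d i`, `0 < i`, lie strictly to one
side of the line through `0` and the value for `i = 0`, so they cannot cancel. -/
theorem aeval_sum_eulerianRefinement_ne_zero {z : ℂ} (hz : 0 < z.im) {d : ℕ} {c : ℕ → ℕ}
    (hc : ∃ i ≤ d, c i ≠ 0) :
    aeval z (∑ i ∈ Finset.range (d + 1), C (c i : ℚ) * eulerianRefinement d i) ≠ 0 := by
  have ha := isArgIncreasing_eulerianRefinement hz d
  set a : ℕ → ℂ := fun i => aeval z (eulerianRefinement d i)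
  have hval : aeval z (∑ i ∈ Finset.range (d + 1), C (c i : ℚ) * eulerianRefinement d i)
      = ∑ i ∈ Finset.range (d + 1), (c i : ℂ) * a i := by
    simp [a, map_sum]
  rw [hval, Finset.sum_range_succ']
  intro h0
  have him := congrArg (fun w => (w * starRingEnd ℂ (a 0)).im) h0
  have hterm : ∀ i, ((c i : ℂ) * a i * starRingEnd ℂ (a 0)).im
      = c i * (a i * starRingEnd ℂ (a 0)).im := by
    intro i
    rw [mul_assoc, ← Complex.ofReal_natCast, Complex.im_ofReal_mul]
  simp only [add_mul, Finset.sum_mul, Complex.add_im, Complex.im_sum, zero_mul, Complex.zero_im,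
    hterm] at him
  rw [Complex.mul_conj, Complex.ofReal_im, mul_zero, add_zero] at him
  have hc0 : ∀ i, i < d → c (i + 1) = 0 := by
    intro i hi
    have hnn : ∀ j ∈ Finset.range d,
        0 ≤ (c (j + 1) : ℝ) * (a (j + 1) * starRingEnd ℂ (a 0)).im := fun j hj =>
      mul_nonneg (Nat.cast_nonneg _)
        (ha.pos 0 (j + 1) (by omega) (by have := Finset.mem_range.1 hj; omega)).le
    have := (Finset.sum_eq_zero_iff_of_nonneg hnn).1 him i (Finset.mem_range.2 hi)
    have hp := ha.pos 0 (i + 1) (by omega) (by omega)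
    exact_mod_cast (mul_eq_zero.1 this).resolve_right hp.ne'
  rw [Finset.sum_eq_zero (fun i hi => by rw [hc0 i (Finset.mem_range.1 hi)]; simp), zero_add] at h0
  obtain ⟨i, hi, hci⟩ := hc
  cases i with
  | zero => exact (mul_ne_zero (Nat.cast_ne_zero.2 hci) (ha.ne_zero 0 (Nat.zero_le _))) h0
  | succ i => exact hci (hc0 i (by omega))

theorem isRealRooted_of_aeval_ne_zero {p : ℚ[X]} (h : ∀ z : ℂ, 0 < z.im → aeval z p ≠ 0) :
    IsRealRooted p := by
  intro z hz
  rcases lt_trichotomy z.im 0 with hlt | heq | hgt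
  · refine absurd ?_ (h (starRingEnd ℂ z) (by simpa using hlt))
    have hconj := aeval_algHom_apply ((starRingEnd ℂ).toRatAlgHom) z p
    rw [hz, map_zero] at hconj
    exact hconj
  · exact heq
  · exact absurd hz (h z hgt)

/-! ### The Ehrhart polynomial and the `h*`-polynomial -/

theorem mk_eval_mul_one_sub_X_pow {d : ℕ} {c : ℕ → ℕ} {p : ℚ[X]}
    (hp : p = ∑ i ∈ Finset.range (d + 1), C (c i : ℚ) * X ^ i * (1 + X) ^ (d - i)) :
    PowerSeries.mk (fun m : ℕ => p.eval (m : ℚ)) * (1 - PowerSeries.X) ^ (d + 1)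
      = ((∑ i ∈ Finset.range (d + 1), C (c i : ℚ) * eulerianRefinement d i : ℚ[X]) :
          PowerSeries ℚ) := by
  have hmk : PowerSeries.mk (fun m : ℕ => p.eval (m : ℚ))
      = ∑ i ∈ Finset.range (d + 1), PowerSeries.C (c i : ℚ)
        * PowerSeries.mk (fun m : ℕ => (m : ℚ) ^ i * ((m : ℚ) + 1) ^ (d - i)) := by
    ext m
    rw [PowerSeries.coeff_mk, map_sum, hp, eval_finsetSum]
    refine Finset.sum_congr rfl fun i _ => ?_
    rw [PowerSeries.coeff_C_mul, PowerSeries.coeff_mk]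
    simp
    ring
  rw [hmk, Finset.sum_mul, ← coeToPowerSeries.ringHom_apply, map_sum]
  refine Finset.sum_congr rfl fun i hi => ?_
  rw [coeToPowerSeries.ringHom_apply, coe_mul, coe_C,
    coe_eulerianRefinement (Nat.lt_succ_iff.1 (Finset.mem_range.1 hi)), numeratorSeries, mul_assoc]

theorem theorem1p4 (n k : ℕ) (hn : 0 < n) (hk : k ≤ n) :
    (∃! E : ℚ[X], IsEhrhartPolynomial (polytopeQ n k) E) ∧
    (∃! h : ℚ[X], IsHStarPolynomial (polytopeQ n k) h) ∧
    (∀ E : ℚ[X], IsEhrhartPolynomial (polytopeQ n k) E →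
      ∃ c : Fin (n + 1) → ℕ,
        C (n ! : ℚ) * E
          = ∑ i : Fin (n + 1), C (c i : ℚ) * X ^ (i : ℕ) * (1 + X) ^ (n - (i : ℕ))) ∧
    (∀ h : ℚ[X], IsHStarPolynomial (polytopeQ n k) h → IsRealRooted h) := by
  have hn0 : (n ! : ℚ) ≠ 0 := by exact_mod_cast n.factorial_ne_zero
  have hC : C (n ! : ℚ) * C (n ! : ℚ)⁻¹ = 1 := by rw [← C_mul, mul_inv_cancel₀ hn0, C_1]
  obtain ⟨c, hc⟩ := isMagicPositive_fallingDiff n k n le_rfl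
  have hE : ∀ E : ℚ[X], IsEhrhartPolynomial (polytopeQ n k) E ↔
      E = C (n ! : ℚ)⁻¹ * fallingDiff n k n := by
    intro E
    rw [isEhrhartPolynomial_iff hk]
    constructor
    · intro h
      rw [← h, ← mul_assoc, mul_comm (C _) (C _), hC, one_mul]
    · rintro rfl
      rw [← mul_assoc, hC, one_mul]
  set N : ℚ[X] := ∑ i ∈ Finset.range (n + 1), C (c i : ℚ) * eulerianRefinement n i with hN
  have hH : ∀ h : ℚ[X], IsHStarPolynomial (polytopeQ n k) h ↔ h = C (n ! : ℚ)⁻¹ * N := by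
    have hseries : PowerSeries.mk
        (fun m : ℕ => (C (n ! : ℚ)⁻¹ * fallingDiff n k n).eval (m : ℚ))
          * (1 - PowerSeries.X) ^ (polytopeDim (polytopeQ n k) + 1)
        = ((C (n ! : ℚ)⁻¹ * N : ℚ[X]) : PowerSeries ℚ) := by
      have hmk : PowerSeries.mk (fun m : ℕ => (C (n ! : ℚ)⁻¹ * fallingDiff n k n).eval (m : ℚ))
          = PowerSeries.C (n ! : ℚ)⁻¹
            * PowerSeries.mk (fun m : ℕ => (fallingDiff n k n).eval (m : ℚ)) := by
        ext m
        rw [PowerSeries.coeff_C_mul, PowerSeries.coeff_mk, PowerSeries.coeff_mk, eval_mul, eval_C]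
      rw [polytopeDim_polytopeQ k hn, hmk, mul_assoc, mk_eval_mul_one_sub_X_pow hc, coe_mul, coe_C]
    intro h
    constructor
    · rintro ⟨E, hE', hh⟩
      rw [(hE E).1 hE', hseries] at hh
      exact (coe_injective ℚ hh).symm
    · rintro rfl
      exact ⟨_, (hE _).2 rfl, hseries⟩
  -- not all `c i` vanish, because the polytope contains a lattice point
  have hc0 : ∃ i ≤ n, c i ≠ 0 := by
    by_contra! hall
    have hzero : fallingDiff n k n = 0 := by
      rw [hc]
      refine Finset.sum_eq_zero fun i hi => ?_
      simp [hall i (Nat.lt_succ_iff.1 (Finset.mem_range.1 hi))]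
    have h0 := eval_fallingDiff_self hk 0
    rw [hzero, eval_zero, latticePointCount_polytopeQ] at h0
    have hcard : (cappedSimplex n 0 k n).ncard = 0 := by
      exact_mod_cast (mul_eq_zero.1 h0.symm).resolve_left hn0
    rw [Set.ncard_eq_zero ((finite_setOf_sum_add_le n (n * (0 + 1))).subset fun x hx => hx.2)]
      at hcard
    have hmem : (0 : Fin n → ℕ) ∈ cappedSimplex n 0 k n := by simp [cappedSimplex]
    rw [hcard] at hmem
    exact hmem
  refine ⟨⟨_, (hE _).2 rfl, fun E h => (hE E).1 h⟩, ⟨_, (hH _).2 rfl, fun h hh => (hH h).1 hh⟩,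
    fun E h => ⟨fun i => c i, ?_⟩, fun h hh => ?_⟩
  · rw [(isEhrhartPolynomial_iff hk E).1 h, hc, Finset.sum_range]
  · rw [(hH h).1 hh]
    refine isRealRooted_of_aeval_ne_zero fun z hz => ?_
    rw [map_mul, aeval_C]
    refine mul_ne_zero ?_ (aeval_sum_eulerianRefinement_ne_zero hz hc0)
    simpa using n.factorial_ne_zero
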